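/- For positive integers $n,m$, an instance of $\textsc{XOR-Missing-String}(n,m)$ is a pair $(X,Y)$ where $X=(x_1,\dots,x_m)$ and $Y=(y_1,\dots,y_m)$ are lists of $m$ strings in $\{0,1\}^n$; a string $s\in\{0,1\}^n$ is a solution to $(X,Y)$ if $s\neq x_a\oplus y_b$ for all $1\le a,b\le m$, where $\oplus$ is bitwise XOR. A deterministic communication protocol is a finite protocol tree: at each internal node one fixed party (Alice or Bob) sends one bit determined by its own input, and each leaf is labelled with an output. A randomized communication protocol consists of an integer $k\ge 0$ and deterministic protocols $(\Pi_r)_{r\in\{0,1\}^k}$; a uniformly random public string $r\in\{0,1\}^k$ is drawn and $\Pi_r$ is executed. Its communication complexity is the maximum, over all inputs and all $r$, of the number of bits communicated (random bits are not counted). For an integer $C\ge 0$ let $n_1=2^C$, $n_i=n_{i-1}^4$ for $i>1$, and $m_i=n_i^{100}$ for $i\ge 1$. Let $p_1=0.6$ and $p_i=p_{i-1}+\frac{1}{10i^2}$ for $i>1$. **Theorem.** There is a constant $C_0$ such that for every integer $C\ge C_0$ the following holds. Let $t\ge 1$ be an integer and let $\{Q_{i,j}\}_{1\le j\le i\le t}$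 be randomized communication protocols such that - in each $Q_{i,j}$, Alice receives $\vec X=(X_1,\dots,X_t)$ and Bob receives $\vec Y=(Y_1,\dots,Y_t)$, where each $(X_k,Y_k)$ is an instance of $\textsc{XOR-Missing-String}(n_k,m_k)$; - the communication complexity of $Q_{i,j}$ is at most $n_i^4$, and $Q_{i,j}$ outputs a string of length $n_i$. Then there are inputs $\vec X,\vec Y$ such that every $Q_{i,j}$ fails to solve the instance $(X_i,Y_i)$; that is, for all $1\le j\le i\le t$: - either no string is output by $Q_{i,j}(\vec X,\vec Y)$ with probability $>p_t$; or - the (unique) string output by $Q_{i,j}(\vec X,\vec Y)$ with probability $>p_t$ is not a solution to $\textsc{XOR-Missing-String}$ on $(X_i,Y_i)$. -/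

import Mathlib

/-- A bit string of length `n`. -/
abbrev BitStr (n : ℕ) : Type := Fin n → Bool

/-- One party's input to XOR-Missing-String with parameters `n`, `m`:
a list of `m` strings of length `n` (repetitions allowed). -/
abbrev StrList (n m : ℕ) : Type := Fin m → BitStr n

/-- `s` is a solution of the XOR-Missing-String instance `(x, y)`: it differs from the bitwise
XOR of `x a` and `y b` for all `a`, `b`. -/
def IsMissingXor {n m : ℕ} (x y : StrList n m) (s : BitStr n) : Prop :=
  ∀ a b : Fin m, s ≠ fun k => xor (x a k) (y b k)

/-- Deterministic two-party communication protocols (protocol trees). Alice holds an element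
of `A`, Bob an element of `B`. At an internal node the indicated party sends one bit, which
depends on its own input and on the node (that is, on the transcript so far); a leaf carries
the output. -/
inductive DetProtocol (A B O : Type) : Type
  | output (o : O) : DetProtocol A B O
  | alice (f : A → Bool) (next : Bool → DetProtocol A B O) : DetProtocol A B O
  | bob (g : B → Bool) (next : Bool → DetProtocol A B O) : DetProtocol A B O

namespace DetProtocol

variable {A B O : Type}

/-- The output of a deterministic protocol. -/
def run : DetProtocol A B O → A → B → O
  | output o, _, _ => o
  | alice f next, x, y => (next (f x)).run x y
  | bob g next, x, y => (next (g y)).run x y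

/-- The number of bits communicated on a given input. -/
def bits : DetProtocol A B O → A → B → ℕ
  | output _, _, _ => 0
  | alice f next, x, y => (next (f x)).bits x y + 1
  | bob g next, x, y => (next (g y)).bits x y + 1

end DetProtocol

/-- Randomized (public-coin) protocols: a uniformly random string of `coins` bits, visible to
both parties, selects the deterministic protocol to be executed. -/
structure RandProtocol (A B O : Type) : Type where
  coins : ℕ
  det : BitStr coins → DetProtocol A B O

namespace RandProtocol

variable {A B O : Type}

/-- The communication complexity: the maximum number of bits communicated, over all inputs and
all random strings. The random bits themselves are free. -/
noncomputable def complexity (Q : RandProtocol A B O) : ℕ∞ :=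
  ⨆ (r : BitStr Q.coins) (x : A) (y : B), ((Q.det r).bits x y : ℕ∞)

open Classical in
/-- The probability, over the public random string, that the protocol outputs `o` on `(x, y)`. -/
noncomputable def prob (Q : RandProtocol A B O) (x : A) (y : B) (o : O) : ℝ :=
  ((Finset.univ.filter fun r : BitStr Q.coins => (Q.det r).run x y = o).card : ℝ) / 2 ^ Q.coins

end RandProtocol

/-- The string lengths `n_1 = 2 ^ C`, `n_i = n_{i-1} ^ 4` for `i > 1` (index `0` is unused). -/
def strLen (C : ℕ) : ℕ → ℕ
  | 0 => 0
  | 1 => 2 ^ C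
  | i + 2 => strLen C (i + 1) ^ 4

/-- The list lengths `m_i = n_i ^ 100`. -/
def listLen (C i : ℕ) : ℕ := strLen C i ^ 100

/-- The thresholds `p_1 = 0.6`, `p_i = p_{i-1} + 1 / (10 i ^ 2)` for `i > 1`
(index `0` is unused). -/
noncomputable def threshold : ℕ → ℝ
  | 0 => 0
  | 1 => 0.6
  | i + 2 => threshold (i + 1) + 1 / (10 * ((i + 2 : ℕ) : ℝ) ^ 2)

/-- One party's input in the multi-instance problem: a `t`-tuple whose `i`-th component,
`1 ≤ i ≤ t`, is that party's half of an instance of XOR-Missing-String with parameters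
`n_i`, `m_i`. The element `i : Fin t` stands for the index `i + 1`. -/
abbrev MultiInput (C t : ℕ) : Type :=
  (i : Fin t) → StrList (strLen C (i + 1)) (listLen C (i + 1))

/-- On input `(X, Y)` and with threshold `p`, the protocol `Q` fails to solve the instance
`(x, y)`: either no string is output with probability greater than `p`, or the unique string
output with probability greater than `p` is not a solution of `(x, y)`. -/
def FailsOn {A B : Type} {n m : ℕ} (Q : RandProtocol A B (BitStr n)) (X : A) (Y : B)
    (p : ℝ) (x y : StrList n m) : Prop :=
  (¬ ∃ s, Q.prob X Y s > p) ∨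
    ∃ s, Q.prob X Y s > p ∧ (∀ s', Q.prob X Y s' > p → s' = s) ∧ ¬ IsMissingXor x y s

/-! The proof counts inputs, adding one instance at a time. Let `n` be the string length of the
current instance. The claim is that the inputs on which all protocols for the earlier instances fail
have density at least `2 ^ (-n)`.

For the inductive step, every coordinate except the current instance is frozen. All protocols
involved then become protocols on a single pair of lists. By `RandProtocol.exists_label`, a good
choice of `K` sampled coin strings replaces each of them by a labelling with few rectangles. Off a
tiny exceptional set, the label names the likely output, up to a small gap in the threshold. On each
rectangle of the common refinement all labels are constant. Failure on the earlier, frozen instances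
therefore depends only on the rectangle, and the candidate outputs for the current instance are
fixed strings. Since the lists are far longer than the logarithm of the number of rectangles, these
strings can be planted as XORs inside every rectangle that is not tiny
(`exists_planted_subrectangle`), at a cost of at most `2 ^ (n ^ 2)` in size (`card_fail_le`).

Averaging over the frozen coordinates turns density `2 ^ (-n)` into about `2 ^ (-n ^ 2 - n)`, which
is above `2 ^ (-n ^ 4)`, the bound claimed for the next string length. The threshold gaps are
summable, so all thresholds used stay between `1 / 2` and `6 / 10`, hence below `threshold t`. -/

open Finset

/-! ### Planting prescribed XORs in dense rectangles -/

section Planting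

variable {n m : ℕ}

/-- A dense set of lists has a coordinate at which more than half of all strings occur with
nearly the uniform frequency. -/
theorem exists_spread_coordinate {D : ℕ} (S : Finset (StrList n m))
    (hS : Fintype.card (StrList n m) ≤ 2 ^ D * #S) (hD : 8 * (D + 1) < m) :
    ∃ a : Fin m, 2 ^ n < 2 * #{u : BitStr n | #S ≤ 2 ^ (n + 3) * #{x ∈ S | x a = u}} := by
  classical
  by_contra! hcon
  -- Values whose frequency at `a` is less than an eighth of uniform. The negated conclusion says
  -- that at every coordinate they make up at least half of all strings.
  set bad : Fin m → Finset (BitStr n) := fun a =>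
    {u | 2 ^ (n + 3) * #{x ∈ S | x a = u} < #S} with hbad
  have hcardU : Fintype.card (BitStr n) = 2 ^ n := by simp
  have hbadcard : ∀ a, 2 ^ n ≤ 2 * #(bad a) := by
    intro a
    have h1 := Finset.card_filter_add_card_filter_not (s := (univ : Finset (BitStr n)))
      (fun u => #S ≤ 2 ^ (n + 3) * #{x ∈ S | x a = u})
    have h2 : #(bad a) =
        #{u : BitStr n | ¬ #S ≤ 2 ^ (n + 3) * #{x ∈ S | x a = u}} := by
      simp only [hbad, not_le]
    rw [Finset.card_univ, hcardU] at h1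
    have := hcon a
    omega
  set cnt : StrList n m → ℕ := fun x => #{a | x a ∈ bad a} with hcnt
  -- Although numerous, the bad values at one coordinate carry at most an eighth of `S`, so a list
  -- in `S` has at most `m / 8` bad coordinates on average.
  have hsum : 8 * ∑ x ∈ S, cnt x ≤ m * #S := by
    have h1 : ∑ x ∈ S, cnt x = ∑ a, #{x ∈ S | x a ∈ bad a} := by
      simp only [hcnt, Finset.card_filter]
      exact Finset.sum_comm
    have h2 : ∀ a, 8 * #{x ∈ S | x a ∈ bad a} ≤ #S := by
      intro a
      have h3 : #{x ∈ S | x a ∈ bad a} = ∑ u ∈ bad a, #{x ∈ S | x a = u} := by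
        rw [Finset.card_eq_sum_card_fiberwise (f := fun x => x a) (t := bad a)]
        · refine Finset.sum_congr rfl fun u hu => ?_
          rw [Finset.filter_filter]
          congr 1
          ext x
          simp only [Finset.mem_filter]
          constructor
          · rintro ⟨h, _, h'⟩; exact ⟨h, h'⟩
          · rintro ⟨h, h'⟩; exact ⟨h, h' ▸ hu, h'⟩
        · intro x hx
          exact (Finset.mem_filter.mp hx).2
      have h4 : 2 ^ (n + 3) * #{x ∈ S | x a ∈ bad a} ≤ 2 ^ n * #S := by
        rw [h3, Finset.mul_sum]
        calc ∑ u ∈ bad a, 2 ^ (n + 3) * #{x ∈ S | x a = u} ≤ ∑ u ∈ bad a, #S :=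
              Finset.sum_le_sum fun u hu => (Finset.mem_filter.mp hu).2.le
          _ = #(bad a) * #S := by simp
          _ ≤ 2 ^ n * #S := by
              refine Nat.mul_le_mul_right _ ?_
              rw [← hcardU]
              exact Finset.card_le_univ _
      have h5 : 2 ^ n * (8 * #{x ∈ S | x a ∈ bad a}) ≤ 2 ^ n * #S := by
        calc _ = 2 ^ (n + 3) * #{x ∈ S | x a ∈ bad a} := by ring
          _ ≤ _ := h4
      exact Nat.le_of_mul_le_mul_left h5 (by positivity)
    rw [h1, Finset.mul_sum]
    calc ∑ a, 8 * #{x ∈ S | x a ∈ bad a} ≤ ∑ _a : Fin m, #S := Finset.sum_le_sum fun a _ => h2 a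
      _ = m * #S := by simp
  have hm : 0 < m := by omega
  -- By Markov's inequality this is at least half of `S`.
  set S' := {x ∈ S | 4 * cnt x ≤ m} with hS'
  have hS'card : #S ≤ 2 * #S' := by
    have h1 := Finset.card_filter_add_card_filter_not (s := S) (fun x => 4 * cnt x ≤ m)
    set R := {x ∈ S | ¬ 4 * cnt x ≤ m} with hR
    have h2 : m * #R ≤ 4 * ∑ x ∈ S, cnt x := by
      calc m * #R = ∑ _x ∈ R, m := by simp [mul_comm]
        _ ≤ ∑ x ∈ R, 4 * cnt x := Finset.sum_le_sum fun x hx => by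
            have := (Finset.mem_filter.mp hx).2
            omega
        _ ≤ ∑ x ∈ S, 4 * cnt x :=
            Finset.sum_le_sum_of_subset (Finset.filter_subset _ _)
        _ = _ := by rw [Finset.mul_sum]
    have h3 : m * (2 * #R) ≤ m * #S := by
      calc m * (2 * #R) = 2 * (m * #R) := by ring
        _ ≤ 2 * (4 * ∑ x ∈ S, cnt x) := Nat.mul_le_mul_left _ h2
        _ = 8 * ∑ x ∈ S, cnt x := by ring
        _ ≤ _ := hsum
    have h4 := Nat.le_of_mul_le_mul_left h3 hm
    have h5 : #S' + #R = #S := h1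
    omega
  -- Exponential tilting: a uniform list has mean weight at most `(3 / 2) ^ m`, whereas every list
  -- in `S'` has weight at least `2 ^ (3 * m / 4)`. Hence `S'` is exponentially small.
  set w : StrList n m → ℕ := fun x => ∏ a, if x a ∈ bad a then 1 else 2 with hw
  have hwx : ∀ x, w x = 2 ^ (m - cnt x) := by
    intro x
    have h1 := Finset.card_filter_add_card_filter_not (s := (univ : Finset (Fin m)))
      (fun a => x a ∈ bad a)
    simp only [hw, Finset.prod_ite, Finset.prod_const, one_pow, one_mul]
    congr 1
    rw [Finset.card_univ, Fintype.card_fin] at h1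
    simp only [hcnt]
    omega
  have hwsum : 2 ^ m * ∑ x, w x ≤ 3 ^ m * Fintype.card (StrList n m) := by
    have h1 : ∑ x, w x = ∏ a, ∑ u : BitStr n, (if u ∈ bad a then 1 else 2) := by
      rw [Finset.prod_univ_sum]
      simp [hw, Fintype.piFinset_univ]
    have h2 : ∀ a, 2 * ∑ u : BitStr n, (if u ∈ bad a then 1 else 2) ≤ 3 * 2 ^ n := by
      intro a
      have h3 := Finset.card_filter_add_card_filter_not (s := (univ : Finset (BitStr n)))
        (fun u => u ∈ bad a)
      rw [Finset.card_univ, hcardU] at h3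
      rw [Finset.sum_ite]
      simp only [Finset.sum_const, smul_eq_mul, mul_one]
      have h4 : #{u | u ∈ bad a} = #(bad a) := by simp
      have := hbadcard a
      omega
    calc 2 ^ m * ∑ x, w x = ∏ a : Fin m, (2 * ∑ u : BitStr n, (if u ∈ bad a then 1 else 2)) := by
          rw [h1, Finset.prod_mul_distrib]; simp
      _ ≤ ∏ _a : Fin m, (3 * 2 ^ n) := Finset.prod_le_prod' fun a _ => h2 a
      _ = 3 ^ m * Fintype.card (StrList n m) := by simp [mul_pow]
  have hlow : 2 ^ (m - m / 4) * #S' ≤ ∑ x, w x := by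
    calc 2 ^ (m - m / 4) * #S' = ∑ _x ∈ S', 2 ^ (m - m / 4) := by simp [mul_comm]
      _ ≤ ∑ x ∈ S', w x := Finset.sum_le_sum fun x hx => by
          rw [hwx]
          have := (Finset.mem_filter.mp hx).2
          exact Nat.pow_le_pow_right (by norm_num) (by omega)
      _ ≤ ∑ x, w x := Finset.sum_le_sum_of_subset (Finset.subset_univ _)
  have hpos : 0 < #S' := by
    have : 0 < Fintype.card (StrList n m) := Fintype.card_pos
    rcases Nat.eq_zero_or_pos #S' with h | h
    · have : #S = 0 := by omega
      rw [this] at hS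
      omega
    · exact h
  have hmain : 2 ^ (2 * m - m / 4) ≤ 3 ^ m * 2 ^ (D + 1) := by
    refine Nat.le_of_mul_le_mul_right ?_ hpos
    calc 2 ^ (2 * m - m / 4) * #S' = 2 ^ m * (2 ^ (m - m / 4) * #S') := by
          rw [← mul_assoc, ← pow_add]; congr 2; omega
      _ ≤ 2 ^ m * ∑ x, w x := Nat.mul_le_mul_left _ hlow
      _ ≤ 3 ^ m * Fintype.card (StrList n m) := hwsum
      _ ≤ 3 ^ m * (2 ^ D * (2 * #S')) :=
          Nat.mul_le_mul_left _ (hS.trans (Nat.mul_le_mul_left _ hS'card))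
      _ = _ := by ring
  -- Eighth powers clear the fraction in the exponent and let `8 * (D + 1) < m` absorb the density;
  -- the contradiction is `3 ^ 8 < 2 ^ 13`.
  have h8 : (2 ^ (2 * m - m / 4)) ^ 8 ≤ (3 ^ m * 2 ^ (D + 1)) ^ 8 := Nat.pow_le_pow_left hmain 8
  have h9 : (2 : ℕ) ^ (13 * m) * 2 ^ m ≤ 3 ^ (8 * m) * 2 ^ m := by
    calc (2 : ℕ) ^ (13 * m) * 2 ^ m = 2 ^ (14 * m) := by rw [← pow_add]; congr 1; ring
      _ ≤ 2 ^ ((2 * m - m / 4) * 8) := Nat.pow_le_pow_right (by norm_num) (by omega)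
      _ = (2 ^ (2 * m - m / 4)) ^ 8 := by rw [pow_mul]
      _ ≤ _ := h8
      _ = 3 ^ (8 * m) * 2 ^ (8 * (D + 1)) := by
          rw [mul_pow, ← pow_mul, ← pow_mul, mul_comm m 8, mul_comm (D + 1) 8]
      _ ≤ _ := Nat.mul_le_mul_left _ (Nat.pow_le_pow_right (by norm_num) (by omega))
  have h10 : (2 : ℕ) ^ (13 * m) ≤ 3 ^ (8 * m) := Nat.le_of_mul_le_mul_right h9 (by positivity)
  rw [pow_mul, pow_mul] at h10
  exact absurd h10 (not_le.mpr (Nat.pow_lt_pow_left (by norm_num) hm.ne'))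

/-- Every dense rectangle of pairs of lists contains a subrectangle, smaller by a factor
exponential only in the string length, on which given strings are all covered. -/
theorem exists_planted_subrectangle (σ : List (BitStr n)) {D : ℕ} (S T : Finset (StrList n m))
    (hS : Fintype.card (StrList n m) ≤ 2 ^ D * #S) (hT : Fintype.card (StrList n m) ≤ 2 ^ D * #T)
    (hD : 8 * (D + σ.length * (n + 3) + 1) < m) :
    ∃ S' ⊆ S, ∃ T' ⊆ T, #S ≤ 2 ^ (σ.length * (n + 3)) * #S' ∧
      #T ≤ 2 ^ (σ.length * (n + 3)) * #T' ∧
      ∀ x ∈ S', ∀ y ∈ T', ∀ s ∈ σ, ¬ IsMissingXor x y s := by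
  classical
  induction σ generalizing D S T with
  | nil => exact ⟨S, subset_rfl, T, subset_rfl, by simp, by simp, by simp⟩
  | cons s σ ih =>
    simp only [List.length_cons, add_mul, one_mul] at hD ⊢
    have hD' : 8 * (D + 1) < m := by omega
    obtain ⟨a, ha⟩ := exists_spread_coordinate S hS hD'
    obtain ⟨b, hb⟩ := exists_spread_coordinate T hT hD'
    set U : Finset (BitStr n) := {u | #S ≤ 2 ^ (n + 3) * #{x ∈ S | x a = u}} with hU
    set V : Finset (BitStr n) := {u | #T ≤ 2 ^ (n + 3) * #{x ∈ T | x b = u}} with hV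
    let sh : BitStr n → BitStr n := fun u k => xor (s k) (u k)
    have hsh : Function.Injective sh := by
      intro u v huv
      funext k
      have := congrFun huv k
      simpa [sh] using this
    -- `U` and the translate of `V` by `s` each contain more than half of all strings, so they meet,
    -- giving `u ∈ U` and `v ∈ V` with XOR `s`.
    have hinter : (U ∩ V.image sh).Nonempty := by
      rw [Finset.nonempty_iff_ne_empty]
      intro he
      have h1 := Finset.card_union_add_card_inter U (V.image sh)
      rw [he, Finset.card_image_of_injective _ hsh, Finset.card_empty] at h1
      have h2 : #(U ∪ V.image sh) ≤ 2 ^ n := by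
        calc _ ≤ Fintype.card (BitStr n) := Finset.card_le_univ _
          _ = 2 ^ n := by simp
      omega
    obtain ⟨u, hu⟩ := hinter
    rw [Finset.mem_inter, Finset.mem_image] at hu
    obtain ⟨huU, v, hvV, hvu⟩ := hu
    have hSu : #S ≤ 2 ^ (n + 3) * #{x ∈ S | x a = u} := (Finset.mem_filter.mp huU).2
    have hTv : #T ≤ 2 ^ (n + 3) * #{x ∈ T | x b = v} := (Finset.mem_filter.mp hvV).2
    obtain ⟨S', hS', T', hT', hcS, hcT, hpl⟩ := ih (D := D + (n + 3))
      {x ∈ S | x a = u} {x ∈ T | x b = v}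
      (by rw [pow_add, mul_assoc]; exact hS.trans (Nat.mul_le_mul_left _ hSu))
      (by rw [pow_add, mul_assoc]; exact hT.trans (Nat.mul_le_mul_left _ hTv)) (by omega)
    refine ⟨S', hS'.trans (Finset.filter_subset _ _), T', hT'.trans (Finset.filter_subset _ _),
      ?_, ?_, ?_⟩
    · rw [add_comm, pow_add, mul_assoc]
      exact hSu.trans (Nat.mul_le_mul_left _ hcS)
    · rw [add_comm, pow_add, mul_assoc]
      exact hTv.trans (Nat.mul_le_mul_left _ hcT)
    · intro x hx y hy s' hs'
      rcases List.mem_cons.mp hs' with rfl | hs'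
      · intro hmiss
        refine hmiss a b ?_
        have hxa : x a = u := (Finset.mem_filter.mp (hS' hx)).2
        have hyb : y b = v := (Finset.mem_filter.mp (hT' hy)).2
        funext k
        rw [hxa, hyb, ← hvu]
        simp [sh]
      · exact hpl x hx y hy s' hs'

end Planting

/-! ### Partitions into rectangles -/

/-- The function `f` of two parties' inputs is constant on the parts of a partition of the input
space into at most `N` combinatorial rectangles. -/
def RectLabelled {A B L : Type} (N : ℕ) (f : A → B → L) : Prop :=
  ∃ (T : Type) (_ : Fintype T) (tr : A → B → T), Fintype.card T ≤ N ∧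
    (∀ x y x' y', tr x y = tr x' y' → tr x y' = tr x y) ∧
    ∀ x y x' y', tr x y = tr x' y' → f x y = f x' y'

theorem RectLabelled.comp {A B L L' : Type} {N : ℕ} {f : A → B → L} (hf : RectLabelled N f)
    (g : L → L') : RectLabelled N fun x y => g (f x y) := by
  obtain ⟨T, hT, tr, hc, hr, hd⟩ := hf
  exact ⟨T, hT, tr, hc, hr, fun x y x' y' h => congrArg g (hd x y x' y' h)⟩

theorem RectLabelled.prodMk {A B L L' : Type} {N N' : ℕ} {f : A → B → L} {g : A → B → L'}
    (hf : RectLabelled N f) (hg : RectLabelled N' g) :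
    RectLabelled (N * N') fun x y => (f x y, g x y) := by
  obtain ⟨T, hT, tr, hc, hr, hd⟩ := hf
  obtain ⟨T', hT', tr', hc', hr', hd'⟩ := hg
  refine ⟨T × T', inferInstance, fun x y => (tr x y, tr' x y), ?_, ?_, ?_⟩
  · rw [Fintype.card_prod]
    exact Nat.mul_le_mul hc hc'
  · intro x y x' y' h
    rw [Prod.mk.injEq] at h
    exact Prod.ext (hr x y x' y' h.1) (hr' x y x' y' h.2)
  · intro x y x' y' h
    rw [Prod.mk.injEq] at h
    exact Prod.ext (hd x y x' y' h.1) (hd' x y x' y' h.2)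

theorem RectLabelled.pi {A B ι : Type} [Fintype ι] {L : ι → Type} {N : ℕ}
    {f : (q : ι) → A → B → L q} (hf : ∀ q, RectLabelled N (f q)) :
    RectLabelled (N ^ Fintype.card ι) fun x y q => f q x y := by
  classical
  choose T hT tr hc hr hd using hf
  refine ⟨(q : ι) → T q, inferInstance, fun x y q => tr q x y, ?_, ?_, ?_⟩
  · rw [Fintype.card_pi]
    calc ∏ q, Fintype.card (T q) ≤ ∏ _q : ι, N := Finset.prod_le_prod' fun q _ => hc q
      _ = _ := by simp
  · intro x y x' y' h
    funext q
    exact hr q x y x' y' (congrFun h q)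
  · intro x y x' y' h
    funext q
    exact hd q x y x' y' (congrFun h q)

/-- The transcript, padded to length `c`. -/
theorem DetProtocol.exists_transcript {A B O : Type} (P : DetProtocol A B O) (c : ℕ) :
    ∃ tr : A → B → Fin c → Bool,
      (∀ x y x' y', tr x y = tr x' y' → tr x y' = tr x y) ∧
      ∀ x y x' y', P.bits x y ≤ c → P.bits x' y' ≤ c → tr x y = tr x' y' →
        P.run x y = P.run x' y' := by
  induction P generalizing c with
  | output o => exact ⟨fun _ _ _ => false, fun _ _ _ _ _ => rfl, fun _ _ _ _ _ _ _ => rfl⟩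
  | alice f next ih =>
    cases c with
    | zero =>
      refine ⟨fun _ _ _ => false, fun _ _ _ _ _ => rfl, fun x y x' y' h => ?_⟩
      simp [DetProtocol.bits] at h
    | succ c =>
      choose tr hr hd using fun b => ih b c
      refine ⟨fun x y => Fin.cons (f x) (tr (f x) x y), ?_, ?_⟩
      · intro x y x' y' h
        rw [Fin.cons_inj] at h
        obtain ⟨h1, h2⟩ := h
        rw [← h1] at h2
        exact congrArg _ (hr _ x y x' y' h2)
      · intro x y x' y' hb hb' h
        rw [Fin.cons_inj] at h
        obtain ⟨h1, h2⟩ := h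
        simp only [DetProtocol.bits, DetProtocol.run, ← h1] at h2 hb hb' ⊢
        exact hd _ x y x' y' (by omega) (by omega) h2
  | bob g next ih =>
    cases c with
    | zero =>
      refine ⟨fun _ _ _ => false, fun _ _ _ _ _ => rfl, fun x y x' y' h => ?_⟩
      simp [DetProtocol.bits] at h
    | succ c =>
      choose tr hr hd using fun b => ih b c
      refine ⟨fun x y => Fin.cons (g y) (tr (g y) x y), ?_, ?_⟩
      · intro x y x' y' h
        rw [Fin.cons_inj] at h
        obtain ⟨h1, h2⟩ := h
        rw [← h1] at h2
        beta_reduce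
        rw [← h1, hr _ x y x' y' h2]
      · intro x y x' y' hb hb' h
        rw [Fin.cons_inj] at h
        obtain ⟨h1, h2⟩ := h
        simp only [DetProtocol.bits, DetProtocol.run, ← h1] at h2 hb hb' ⊢
        exact hd _ x y x' y' (by omega) (by omega) h2

theorem DetProtocol.rectLabelled_run {A B O : Type} (P : DetProtocol A B O) {c : ℕ}
    (h : ∀ x y, P.bits x y ≤ c) : RectLabelled (2 ^ c) P.run := by
  obtain ⟨tr, hr, hd⟩ := P.exists_transcript c
  exact ⟨Fin c → Bool, inferInstance, tr, by simp, hr,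
    fun x y x' y' e => hd x y x' y' (h x y) (h x' y') e⟩

open Classical in
/-- Given a labelling of all pairs of lists by few rectangles, the strings named by the label are
all covered on a not too small part of any set of labels. -/
theorem card_planted_ge {n m D N : ℕ} {J L : Type} [Fintype J]
    {f : StrList n m → StrList n m → L} (hf : RectLabelled N f) (G : L → Prop)
    (s : L → J → BitStr n) (hD : 8 * (D + Fintype.card J * (n + 3) + 1) < m) :
    (#{z : StrList n m × StrList n m | G (f z.1 z.2)} : ℝ) ≤
      2 ^ (2 * (Fintype.card J * (n + 3))) *
        #{z : StrList n m × StrList n m | G (f z.1 z.2) ∧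
          ∀ j, ¬ IsMissingXor z.1 z.2 (s (f z.1 z.2) j)} +
      N * ((1 / 2) ^ D * Fintype.card (StrList n m × StrList n m)) := by
  obtain ⟨T, hT, tr, hc, hr, hd⟩ := hf
  set E := Fintype.card J * (n + 3) with hE
  set M := Fintype.card (StrList n m) with hM
  have key : ∀ τ : T,
      (#{z : StrList n m × StrList n m | G (f z.1 z.2) ∧ tr z.1 z.2 = τ} : ℝ) ≤
      2 ^ (2 * E) * #{z : StrList n m × StrList n m | (G (f z.1 z.2) ∧
          ∀ j, ¬ IsMissingXor z.1 z.2 (s (f z.1 z.2) j)) ∧ tr z.1 z.2 = τ} +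
      (1 / 2) ^ D * ((M : ℝ) * M) := by
    intro τ
    by_cases hne : ∃ x y, tr x y = τ ∧ G (f x y)
    swap
    · have : ({z : StrList n m × StrList n m | G (f z.1 z.2) ∧ tr z.1 z.2 = τ} : Finset _) = ∅ := by
        ext z
        simp only [Finset.mem_filter, Finset.mem_univ, true_and, Finset.notMem_empty, iff_false]
        exact fun h => hne ⟨z.1, z.2, h.2, h.1⟩
      rw [this, Finset.card_empty]
      push_cast
      positivity
    obtain ⟨x₀, y₀, h₀, hG₀⟩ := hne
    set S : Finset (StrList n m) := {x | ∃ y, tr x y = τ} with hS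
    set R : Finset (StrList n m) := {y | ∃ x, tr x y = τ} with hR
    have hrect : ∀ x ∈ S, ∀ y ∈ R, tr x y = τ := by
      intro x hx y hy
      obtain ⟨y', h1⟩ := (Finset.mem_filter.mp hx).2
      obtain ⟨x', h2⟩ := (Finset.mem_filter.mp hy).2
      rw [hr x y' x' y (h1.trans h2.symm), h1]
    have hsub : ({z : StrList n m × StrList n m | G (f z.1 z.2) ∧ tr z.1 z.2 = τ} : Finset _) ⊆
        S ×ˢ R := by
      intro z hz
      have := (Finset.mem_filter.mp hz).2.2
      simp only [hS, hR, Finset.mem_product, Finset.mem_filter, Finset.mem_univ, true_and]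
      exact ⟨⟨_, this⟩, ⟨_, this⟩⟩
    have hle := Finset.card_le_card hsub
    rw [Finset.card_product] at hle
    have hSM : #S ≤ M := Finset.card_le_univ _
    have hRM : #R ≤ M := Finset.card_le_univ _
    -- If the rectangle has density at least `2 ^ (-D)`, so does each side, and planting applies.
    -- Otherwise it is charged to the additive error, paid once per rectangle.
    by_cases hbig : M * M ≤ 2 ^ D * (#S * #R)
    · have hMpos : 0 < M := Fintype.card_pos
      have hS' : M ≤ 2 ^ D * #S := by
        refine Nat.le_of_mul_le_mul_right ?_ hMpos
        calc M * M ≤ 2 ^ D * (#S * #R) := hbig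
          _ ≤ 2 ^ D * (#S * M) := by gcongr
          _ = _ := by ring
      have hR' : M ≤ 2 ^ D * #R := by
        refine Nat.le_of_mul_le_mul_right ?_ hMpos
        calc M * M ≤ 2 ^ D * (#S * #R) := hbig
          _ ≤ 2 ^ D * (M * #R) := by gcongr
          _ = _ := by ring
      have hlen : ((univ : Finset J).toList.map (s (f x₀ y₀))).length = Fintype.card J := by simp
      obtain ⟨S', hSS, R', hRR, h1, h2, h3⟩ := exists_planted_subrectangle
        ((univ : Finset J).toList.map (s (f x₀ y₀))) S R hS' hR' (by rw [hlen]; exact hD)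
      rw [hlen] at h1 h2
      have hsub' : S' ×ˢ R' ⊆ ({z : StrList n m × StrList n m | (G (f z.1 z.2) ∧
          ∀ j, ¬ IsMissingXor z.1 z.2 (s (f z.1 z.2) j)) ∧ tr z.1 z.2 = τ} : Finset _) := by
        intro z hz
        rw [Finset.mem_product] at hz
        have htr := hrect _ (hSS hz.1) _ (hRR hz.2)
        have hfz : f z.1 z.2 = f x₀ y₀ := hd _ _ _ _ (htr.trans h₀.symm)
        simp only [Finset.mem_filter, Finset.mem_univ, true_and, hfz]
        exact ⟨⟨hG₀, fun j => h3 _ hz.1 _ hz.2 _ (by simp)⟩, htr⟩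
      have hle' := Finset.card_le_card hsub'
      rw [Finset.card_product] at hle'
      have : #S * #R ≤ 2 ^ (2 * E) * (#S' * #R') := by
        calc #S * #R ≤ (2 ^ E * #S') * (2 ^ E * #R') := Nat.mul_le_mul h1 h2
          _ = _ := by ring
      have h4 := hle.trans (this.trans (Nat.mul_le_mul_left _ hle'))
      have h5 : (0 : ℝ) ≤ (1 / 2) ^ D * ((M : ℝ) * M) := by positivity
      have h6 := (Nat.cast_le (α := ℝ)).mpr h4
      push_cast at h6
      linarith
    · have h1 : (2 : ℝ) ^ D * (#S * #R) ≤ M * M := by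
        exact_mod_cast (not_le.mp hbig).le
      have h2 : ((#S * #R : ℕ) : ℝ) ≤ (1 / 2) ^ D * ((M : ℝ) * M) := by
        calc ((#S * #R : ℕ) : ℝ) = (1 / 2) ^ D * (2 ^ D * (#S * #R)) := by
              rw [← mul_assoc, ← mul_pow]; norm_num
          _ ≤ _ := by gcongr
      have h3 := (Nat.cast_le (α := ℝ)).mpr hle
      refine (h3.trans h2).trans (le_add_of_nonneg_left (by positivity))
  have hfib : ∀ (P : StrList n m × StrList n m → Prop) [DecidablePred P], (#{z | P z} : ℝ) =
      ∑ τ : T, (#{z : StrList n m × StrList n m | P z ∧ tr z.1 z.2 = τ} : ℝ) := by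
    intro P _
    rw [Finset.card_eq_sum_card_fiberwise (f := fun z => tr z.1 z.2) (t := univ)
      (fun _ _ => Finset.mem_coe.mpr (Finset.mem_univ _))]
    push_cast
    refine Finset.sum_congr rfl fun τ _ => ?_
    rw [Finset.filter_filter]
  rw [hfib, hfib (fun z => G (f z.1 z.2) ∧ ∀ j, ¬ IsMissingXor z.1 z.2 (s (f z.1 z.2) j))]
  refine (Finset.sum_le_sum fun τ _ => key τ).trans ?_
  rw [Finset.sum_add_distrib, ← Finset.mul_sum, Finset.sum_const, Finset.card_univ, nsmul_eq_mul,
    Fintype.card_prod]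
  push_cast
  gcongr

/-! ### Replacing public coins by samples -/

/-- A Chernoff bound for `K` independent samples from a finite set. -/
theorem card_samples_ge_le {Ω : Type} [Fintype Ω] (E : Finset Ω) (K : ℕ)
    {g θ : ℝ} (hg : 0 ≤ g) (hg1 : g ≤ 1)
    (hE : (#E : ℝ) ≤ (θ - g) * Fintype.card Ω) [DecidableEq Ω]
    [DecidablePred fun ρ : Fin K → Ω => θ * K ≤ (#{l | ρ l ∈ E} : ℝ)] :
    (#{ρ : Fin K → Ω | θ * K ≤ (#{l | ρ l ∈ E} : ℝ)} : ℝ) ≤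
      Real.exp (-(K * g ^ 2 / 4)) * (Fintype.card Ω : ℝ) ^ K := by
  -- This minimizes the exponent `lam ^ 2 - lam * g` left after Markov's inequality, with value `-g
  -- ^ 2 / 4`.
  set lam : ℝ := g / 2 with hlam
  set M : ℝ := ((Fintype.card Ω : ℕ) : ℝ) with hM
  set e : Ω → ℝ := fun ω => Real.exp (if ω ∈ E then lam else 0) with he
  have hsum : ∑ ω, e ω ≤ M * Real.exp (lam * (θ - g) + lam ^ 2) := by
    have hM0 : 0 ≤ M := by positivity
    have h1 : ∑ ω, e ω = #E * Real.exp lam + (M - #E) := by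
      have h2 : ∀ ω, e ω = 1 + (if ω ∈ E then Real.exp lam - 1 else 0) := by
        intro ω
        simp only [he]
        split_ifs <;> simp
      rw [Finset.sum_congr rfl fun ω _ => h2 ω, Finset.sum_add_distrib, ← Finset.sum_filter]
      simp [hM]
      ring
    have h3 : Real.exp lam ≤ 1 + lam + lam ^ 2 := by
      have := Real.abs_exp_sub_one_sub_id_le (x := lam) (by rw [abs_le]; constructor <;> linarith)
      have := (abs_le.mp this).2
      linarith
    have h4 : (#E : ℝ) ≤ M := by
      simpa [hM] using (Nat.cast_le (α := ℝ)).mpr (Finset.card_le_univ E)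
    have hlam0 : 0 ≤ lam := by positivity
    calc ∑ ω, e ω = M + #E * (Real.exp lam - 1) := by rw [h1]; ring
      _ ≤ M + #E * (lam + lam ^ 2) := by gcongr; linarith
      _ = M + #E * lam + #E * lam ^ 2 := by ring
      _ ≤ M + ((θ - g) * M) * lam + M * lam ^ 2 := by gcongr
      _ = M * ((lam * (θ - g) + lam ^ 2) + 1) := by ring
      _ ≤ _ := by gcongr; exact Real.add_one_le_exp _
  have hprod : ∑ ρ : Fin K → Ω, ∏ l, e (ρ l) = (∑ ω, e ω) ^ K := by
    have h := Finset.prod_univ_sum (fun _ : Fin K => (univ : Finset Ω)) (fun _ ω => e ω)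
    rw [Fintype.piFinset_univ] at h
    rw [← h]
    simp
  have hval : ∀ ρ : Fin K → Ω, ∏ l, e (ρ l) = Real.exp (lam * #{l | ρ l ∈ E}) := by
    intro ρ
    simp only [he]
    rw [← Real.exp_sum, ← Finset.sum_filter]
    simp [mul_comm]
  have hmarkov : (#{ρ : Fin K → Ω | θ * K ≤ (#{l | ρ l ∈ E} : ℝ)} : ℝ) * Real.exp (lam * (θ * K)) ≤
      (∑ ω, e ω) ^ K := by
    rw [← hprod, ← nsmul_eq_mul, ← Finset.sum_const]
    refine (Finset.sum_le_sum fun ρ hρ => ?_).trans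
      (Finset.sum_le_sum_of_subset_of_nonneg (Finset.subset_univ _)
        fun ρ _ _ => Finset.prod_nonneg fun l _ => (Real.exp_pos _).le)
    rw [hval]
    have := (Finset.mem_filter.mp hρ).2
    gcongr
  have hpow : (∑ ω, e ω) ^ K ≤ (M * Real.exp (lam * (θ - g) + lam ^ 2)) ^ K := by
    refine pow_le_pow_left₀ (Finset.sum_nonneg fun ω _ => (Real.exp_pos _).le) hsum K
  refine le_of_mul_le_mul_right (hmarkov.trans (hpow.trans (le_of_eq ?_)))
    (Real.exp_pos (lam * (θ * K)))
  rw [mul_pow, ← Real.exp_nat_mul, mul_right_comm, ← Real.exp_add, mul_comm]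
  congr 2
  rw [hlam]
  ring

open Classical in
theorem RandProtocol.prob_eq {A B O : Type} (Q : RandProtocol A B O) (x : A) (y : B) (o : O) :
    (#{r | (Q.det r).run x y = o} : ℝ) = Q.prob x y o * Fintype.card (BitStr Q.coins) := by
  simp [RandProtocol.prob]

theorem RandProtocol.bits_le {A B O : Type} {Q : RandProtocol A B O} {c : ℕ}
    (h : Q.complexity ≤ (c : ℕ∞)) (r : BitStr Q.coins) (x : A) (y : B) :
    (Q.det r).bits x y ≤ c := by
  simp only [RandProtocol.complexity, iSup_le_iff, Nat.cast_le] at h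
  exact h r x y

open Classical in
/-- A randomized protocol can be replaced by a labelling by few rectangles which, on all but few
inputs, names the string that is output with a probability above a threshold. -/
theorem RandProtocol.exists_label {A B O : Type} [Fintype A] [Fintype B] [Fintype O]
    (Q : RandProtocol A B O) {c : ℕ} (hc : Q.complexity ≤ (c : ℕ∞)) (K : ℕ)
    {p p' g : ℝ} (hp : 1 / 2 ≤ p) (hg : 0 < g) (hg1 : g ≤ 1) (hpp : p + 2 * g ≤ p') :
    ∃ (f : A → B → Option O) (bad : Finset (A × B)), RectLabelled ((2 ^ c) ^ K) f ∧
      (∀ z ∉ bad, ∀ s, (f z.1 z.2 = some s → p < Q.prob z.1 z.2 s) ∧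
        (p' < Q.prob z.1 z.2 s → f z.1 z.2 = some s)) ∧
      (#bad : ℝ) ≤ Fintype.card O * Real.exp (-(K * g ^ 2 / 4)) * Fintype.card (A × B) := by
  set Ω := BitStr Q.coins with hΩ
  -- The empirical cutoff is at distance at least `g` from both `p` and `p'`, so either kind of
  -- error is a deviation of at least `g`.
  set θ : ℝ := p + g with hθ
  set emp : (Fin K → Ω) → A × B → O → ℕ := fun ρ z s =>
    #{l | (Q.det (ρ l)).run z.1 z.2 = s} with hemp
  set err : (Fin K → Ω) → A × B → O → Prop := fun ρ z s =>
    (θ * K < emp ρ z s ∧ Q.prob z.1 z.2 s ≤ p) ∨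
      ((emp ρ z s : ℝ) ≤ θ * K ∧ p' < Q.prob z.1 z.2 s) with herr
  set ε := Real.exp (-(K * g ^ 2 / 4)) with hε
  have herrcard : ∀ z s, (#{ρ | err ρ z s} : ℝ) ≤ ε * (Fintype.card Ω : ℝ) ^ K := by
    intro z s
    set E : Finset Ω := {r | (Q.det r).run z.1 z.2 = s} with hE
    have hEcard : (#E : ℝ) = Q.prob z.1 z.2 s * Fintype.card Ω := Q.prob_eq _ _ _
    have hempE : ∀ ρ, emp ρ z s = #{l | ρ l ∈ E} := by
      intro ρ
      simp [hemp, hE]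
    rcases le_or_gt (Q.prob z.1 z.2 s) p with h | h
    · refine le_trans ?_ (card_samples_ge_le E K (θ := θ) hg.le hg1 ?_)
      · refine Nat.cast_le.mpr (Finset.card_le_card fun ρ hρ => ?_)
        simp only [Finset.mem_filter, Finset.mem_univ, true_and, herr] at hρ ⊢
        rw [← hempE]
        rcases hρ with hρ | hρ
        · exact hρ.1.le
        · linarith [hρ.2]
      · rw [hEcard]
        gcongr
        linarith
    · by_cases h' : p' < Q.prob z.1 z.2 s
      swap
      · have : ({ρ | err ρ z s} : Finset _) = ∅ := by
          ext ρ
          simp only [Finset.mem_filter, Finset.mem_univ, true_and, herr, Finset.notMem_empty,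
            iff_false]
          rintro (hρ | hρ)
          · linarith [hρ.2]
          · exact h' hρ.2
        rw [this]
        simp only [Finset.card_empty, Nat.cast_zero]
        positivity
      -- The lower tail for `E` is the upper tail for its complement.
      · refine le_trans ?_ (card_samples_ge_le Eᶜ K (θ := 1 - θ) hg.le hg1 ?_)
        · refine Nat.cast_le.mpr (Finset.card_le_card fun ρ hρ => ?_)
          simp only [Finset.mem_filter, Finset.mem_univ, true_and, herr] at hρ ⊢
          rw [hempE] at hρ
          have h1 := Finset.card_filter_add_card_filter_not (s := (univ : Finset (Fin K)))
            (fun l => ρ l ∈ E)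
          rw [Finset.card_univ, Fintype.card_fin] at h1
          have h2 : (#{l | ρ l ∈ E} : ℝ) + #{l | ρ l ∉ E} = K := by exact_mod_cast h1
          simp only [Finset.mem_compl]
          rcases hρ with hρ | hρ
          · linarith [hρ.2]
          · linarith [hρ.1]
        · rw [Finset.card_compl, Nat.cast_sub (Finset.card_le_univ E), hEcard]
          have : (0 : ℝ) ≤ Fintype.card Ω := by positivity
          nlinarith
  have hsumerr : ∑ ρ, (#{z : A × B | ∃ s, err ρ z s} : ℝ) ≤
      ∑ _ρ : Fin K → Ω, (Fintype.card O * ε * Fintype.card (A × B) : ℝ) := by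
    have h1 : ∑ ρ, (#{z : A × B | ∃ s, err ρ z s} : ℝ) =
        ∑ z, (#{ρ | ∃ s, err ρ z s} : ℝ) := by
      simp only [Finset.card_filter]
      push_cast
      exact Finset.sum_comm
    have h2 : ∀ z, (#{ρ | ∃ s, err ρ z s} : ℝ) ≤
        Fintype.card O * (ε * (Fintype.card Ω : ℝ) ^ K) := by
      intro z
      have h3 : ({ρ | ∃ s, err ρ z s} : Finset _) ⊆ univ.biUnion fun s => {ρ | err ρ z s} := by
        intro ρ hρ
        simpa using hρ
      calc (#{ρ | ∃ s, err ρ z s} : ℝ) ≤ ∑ s, (#{ρ | err ρ z s} : ℝ) := by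
            exact_mod_cast (Finset.card_le_card h3).trans Finset.card_biUnion_le
        _ ≤ ∑ _s : O, ε * (Fintype.card Ω : ℝ) ^ K := Finset.sum_le_sum fun s _ => herrcard z s
        _ = _ := by simp
    rw [h1]
    refine (Finset.sum_le_sum fun z _ => h2 z).trans (le_of_eq ?_)
    simp only [Finset.sum_const, Finset.card_univ, nsmul_eq_mul, Fintype.card_pi, Finset.prod_const,
      Fintype.card_fin]
    push_cast
    ring
  -- Some fixed sample does at least as well as the average, which removes the randomness.
  obtain ⟨ρ, -, hρ⟩ := Finset.exists_le_of_sum_le Finset.univ_nonempty hsumerr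
  have hrun : RectLabelled ((2 ^ c) ^ K) fun x y (l : Fin K) => (Q.det (ρ l)).run x y := by
    have := RectLabelled.pi (fun l : Fin K =>
      (Q.det (ρ l)).rectLabelled_run (RandProtocol.bits_le hc (ρ l)))
    rwa [Fintype.card_fin] at this
  set pick : (Fin K → O) → Option O := fun v =>
    if h : ∃ s, θ * K < (#{l | v l = s} : ℝ) then some h.choose else none with hpick
  have hpick_iff : ∀ v s, pick v = some s ↔ θ * K < (#{l | v l = s} : ℝ) := by
    intro v s
    by_cases h : ∃ s, θ * K < (#{l | v l = s} : ℝ)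
    swap
    · simp only [hpick, dif_neg h, reduceCtorEq, false_iff]
      exact fun h' => h ⟨s, h'⟩
    -- As `θ > 1 / 2`, two different strings cannot both win a majority of the samples.
    have huniq : ∀ s s', θ * K < (#{l | v l = s} : ℝ) → θ * K < (#{l | v l = s'} : ℝ) → s = s' := by
      intro s s' h1 h2
      by_contra hne
      have hdisj : Disjoint ({l | v l = s} : Finset (Fin K)) ({l | v l = s'} : Finset (Fin K)) := by
        rw [Finset.disjoint_filter]
        rintro l - rfl
        exact hne
      have h3 := Finset.card_union_of_disjoint hdisj
      have h4 := Finset.card_le_univ (({l | v l = s} : Finset (Fin K)) ∪ ({l | v l = s'} : Finset (Fin K)))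
      rw [h3, Fintype.card_fin] at h4
      have h5 : (#{l | v l = s} : ℝ) + #{l | v l = s'} ≤ K := by exact_mod_cast h4
      have : (0 : ℝ) ≤ K := by positivity
      nlinarith
    simp only [hpick, dif_pos h, Option.some.injEq]
    constructor
    · rintro rfl
      exact h.choose_spec
    · exact fun h' => huniq _ _ h.choose_spec h'
  refine ⟨fun x y => pick fun l => (Q.det (ρ l)).run x y, ({z | ∃ s, err ρ z s} : Finset (A × B)),
    hrun.comp pick, fun z hz s => ?_, hρ⟩
  simp only [Finset.mem_filter, Finset.mem_univ, true_and, not_exists] at hz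
  have hzs := hz s
  simp only [herr, hemp, not_or, not_and, not_lt, not_le] at hzs
  rw [hpick_iff]
  refine ⟨hzs.1, fun h => ?_⟩
  by_contra h'
  exact absurd h (not_lt.mpr (hzs.2 (not_lt.mp h')))

theorem two_pow_mul_half_pow_le {a b c : ℕ} (h : a + c ≤ b) :
    (2 : ℝ) ^ a * (1 / 2) ^ b ≤ (1 / 2) ^ c := by
  obtain ⟨d, rfl⟩ := Nat.exists_eq_add_of_le h
  calc (2 : ℝ) ^ a * (1 / 2) ^ (a + c + d) = (2 * (1 / 2)) ^ a * ((1 / 2) ^ c * (1 / 2) ^ d) := by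
        rw [mul_pow, pow_add, pow_add]; ring
    _ = (1 / 2) ^ c * (1 / 2) ^ d := by norm_num
    _ ≤ (1 / 2) ^ c * 1 := by
        gcongr
        exact pow_le_one₀ (by norm_num) (by norm_num)
    _ = _ := mul_one _

/-! ### The step for a single instance -/

section Stage

variable {n m : ℕ} {ι J : Type} [Fintype ι] [Fintype J] {O : ι → Type} [∀ q, Fintype (O q)]

open Classical in
/-- Pairs of lists on which the protocols `R` fail are not much more frequent than those on which,
with a slightly larger threshold, the protocols `R` and `R'` all fail. -/
theorem card_fail_le_of_samples
    (R : (q : ι) → RandProtocol (StrList n m) (StrList n m) (O q)) (M : (q : ι) → O q → Prop)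
    (R' : J → RandProtocol (StrList n m) (StrList n m) (BitStr n))
    (hO : ∀ q, Fintype.card (O q) ≤ 2 ^ n) {c : ℕ}
    (hR : ∀ q, (R q).complexity ≤ (c : ℕ∞)) (hR' : ∀ j, (R' j).complexity ≤ (c : ℕ∞))
    (K : ℕ) {D : ℕ} (hD : 8 * (D + Fintype.card J * (n + 3) + 1) < m)
    {p p' g : ℝ} (hp : 1 / 2 ≤ p) (hg : 0 < g) (hg1 : g ≤ 1) (hpp : p + 2 * g ≤ p') :
    (#{z : StrList n m × StrList n m | ∀ q s, p < (R q).prob z.1 z.2 s → ¬ M q s} : ℝ) ≤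
      2 ^ (2 * (Fintype.card J * (n + 3))) *
        (#{z : StrList n m × StrList n m | (∀ q s, p' < (R q).prob z.1 z.2 s → ¬ M q s) ∧
            ∀ j s, p' < (R' j).prob z.1 z.2 s → ¬ IsMissingXor z.1 z.2 s} +
          ((Fintype.card ι + Fintype.card J : ℕ) : ℝ) * (2 ^ n * Real.exp (-(K * g ^ 2 / 4)) *
            Fintype.card (StrList n m × StrList n m))) +
      ((Fintype.card ι + Fintype.card J : ℕ) : ℝ) * (2 ^ n * Real.exp (-(K * g ^ 2 / 4)) *
            Fintype.card (StrList n m × StrList n m)) +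
      2 ^ (c * K * (Fintype.card ι + Fintype.card J)) *
        ((1 / 2) ^ D * Fintype.card (StrList n m × StrList n m)) := by
  choose f bad hf hgood hbad using fun q => (R q).exists_label (hR q) K hp hg hg1 hpp
  choose f' bad' hf' hgood' hbad' using fun j => (R' j).exists_label (hR' j) K hp hg hg1 hpp
  have hlab := (RectLabelled.pi hf).prodMk (RectLabelled.pi hf')
  set lab := fun x y => ((fun q => f q x y : (q : ι) → Option (O q)),
    (fun j => f' j x y : J → Option (BitStr n))) with hlabdef
  set β : ℝ := 2 ^ n * Real.exp (-(K * g ^ 2 / 4)) *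
    ((Fintype.card (StrList n m × StrList n m) : ℕ) : ℝ) with hβ
  set B : Finset (StrList n m × StrList n m) := univ.biUnion bad ∪ univ.biUnion bad' with hB
  have hBcard : (#B : ℝ) ≤ ((Fintype.card ι + Fintype.card J : ℕ) : ℝ) * β := by
    have h1 : ∀ q, (#(bad q) : ℝ) ≤ β := fun q => (hbad q).trans (by
      rw [hβ]
      gcongr
      exact_mod_cast hO q)
    have h2 : ∀ j, (#(bad' j) : ℝ) ≤ β := fun j => (hbad' j).trans (by
      rw [hβ]
      gcongr
      simp)
    calc (#B : ℝ) ≤ ∑ q, (#(bad q) : ℝ) + ∑ j, (#(bad' j) : ℝ) := by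
          exact_mod_cast (Finset.card_union_le _ _).trans
            (Nat.add_le_add Finset.card_biUnion_le Finset.card_biUnion_le)
      _ ≤ ∑ _q : ι, β + ∑ _j : J, β :=
          add_le_add (Finset.sum_le_sum fun q _ => h1 q) (Finset.sum_le_sum fun j _ => h2 j)
      _ = _ := by simp [add_mul]
  have hnot : ∀ z ∉ B, (∀ q, z ∉ bad q) ∧ ∀ j, z ∉ bad' j := by
    intro z hz
    simpa [hB] using hz
  -- The failure of the protocols `R`, read off from the label alone. This is possible because `M`
  -- does not depend on the pair of lists, and it is why planting preserves the failure.
  obtain ⟨G, hG⟩ : ∃ G : ((q : ι) → Option (O q)) × (J → Option (BitStr n)) → Prop,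
      ∀ l, G l ↔ ∀ q s, l.1 q = some s → ¬ M q s := ⟨_, fun _ => Iff.rfl⟩
  -- When a label names no string, planting the default one is harmless.
  have hplant := card_planted_ge hlab G (fun l j => (l.2 j).getD default) hD
  have h1 : (#{z : StrList n m × StrList n m | ∀ q s, p < (R q).prob z.1 z.2 s → ¬ M q s} : ℝ) ≤
      #{z : StrList n m × StrList n m | G (lab z.1 z.2)} + #B := by
    have : ({z : StrList n m × StrList n m | ∀ q s, p < (R q).prob z.1 z.2 s → ¬ M q s} : Finset (StrList n m × StrList n m)) ⊆
        (univ.filter fun z => G (lab z.1 z.2)) ∪ B := by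
      intro z hz
      rw [Finset.mem_union]
      by_cases hzB : z ∈ B
      · exact Or.inr hzB
      · refine Or.inl (Finset.mem_filter.mpr ⟨Finset.mem_univ _, (hG _).mpr fun q s hs => ?_⟩)
        exact (Finset.mem_filter.mp hz).2 q s ((hgood q z ((hnot z hzB).1 q) s).1 hs)
    exact_mod_cast (Finset.card_le_card this).trans (Finset.card_union_le _ _)
  have h2 : (#{z : StrList n m × StrList n m | G (lab z.1 z.2) ∧
        ∀ j, ¬ IsMissingXor z.1 z.2 (((lab z.1 z.2).2 j).getD default)} : ℝ) ≤
      #{z : StrList n m × StrList n m | (∀ q s, p' < (R q).prob z.1 z.2 s → ¬ M q s) ∧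
            ∀ j s, p' < (R' j).prob z.1 z.2 s → ¬ IsMissingXor z.1 z.2 s} + #B := by
    have : ({z : StrList n m × StrList n m | G (lab z.1 z.2) ∧
        ∀ j, ¬ IsMissingXor z.1 z.2 (((lab z.1 z.2).2 j).getD default)} : Finset (StrList n m × StrList n m)) ⊆
        (univ.filter fun z => (∀ q s, p' < (R q).prob z.1 z.2 s → ¬ M q s) ∧
            ∀ j s, p' < (R' j).prob z.1 z.2 s → ¬ IsMissingXor z.1 z.2 s) ∪ B := by
      intro z hz
      rw [Finset.mem_union]
      by_cases hzB : z ∈ B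
      · exact Or.inr hzB
      · have hz' := (Finset.mem_filter.mp hz).2
        refine Or.inl (Finset.mem_filter.mpr ⟨Finset.mem_univ _, fun q s hs => ?_, fun j s hs => ?_⟩)
        · exact (hG _).mp hz'.1 q s ((hgood q z ((hnot z hzB).1 q) s).2 hs)
        · have h3 := hz'.2 j
          have h4 : (lab z.1 z.2).2 j = some s := (hgood' j z ((hnot z hzB).2 j) s).2 hs
          rwa [h4] at h3
    exact_mod_cast (Finset.card_le_card this).trans (Finset.card_union_le _ _)
  have hN : ((((2 ^ c) ^ K) ^ Fintype.card ι * ((2 ^ c) ^ K) ^ Fintype.card J : ℕ) : ℝ) =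
      2 ^ (c * K * (Fintype.card ι + Fintype.card J)) := by
    push_cast
    rw [← pow_add, ← pow_mul, ← pow_mul, mul_assoc]
  rw [hN] at hplant
  have h3 := h2.trans (add_le_add_right hBcard _)
  have h4 := mul_le_mul_of_nonneg_left h3
    (by positivity : (0 : ℝ) ≤ 2 ^ (2 * (Fintype.card J * (n + 3))))
  refine h1.trans ((add_le_add (hplant.trans (add_le_add h4 le_rfl)) hBcard).trans (le_of_eq ?_))
  rw [add_right_comm]

-- The choices are `K = n ^ 6` and `D = n ^ 12`. Sampling errors are then about `2 ^ (-4 * n ^ 3)`,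
-- small enough to survive the planting factor `2 ^ (n ^ 2)`. There are at most `2 ^ (n ^ 11)`
-- rectangles, so those of density below `2 ^ (-D)` are negligible in total, and `m = n ^ 100`
-- leaves ample room for planting.
open Classical in
theorem card_fail_le
    (R : (q : ι) → RandProtocol (StrList n m) (StrList n m) (O q)) (M : (q : ι) → O q → Prop)
    (R' : J → RandProtocol (StrList n m) (StrList n m) (BitStr n))
    (hO : ∀ q, Fintype.card (O q) ≤ 2 ^ n)
    (hR : ∀ q, (R q).complexity ≤ ((n ^ 4 : ℕ) : ℕ∞))
    (hR' : ∀ j, (R' j).complexity ≤ ((n ^ 4 : ℕ) : ℕ∞))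
    (hn : 1024 ≤ n) (hm : m = n ^ 100) (hcard : Fintype.card ι + Fintype.card J ≤ n)
    (hJ : 2 * (Fintype.card J * (n + 3)) ≤ n ^ 2)
    {p p' g : ℝ} (hp : 1 / 2 ≤ p) (hg : 1 / (n : ℝ) ≤ g) (hg1 : g ≤ 1) (hpp : p + 2 * g ≤ p') :
    (#{z : StrList n m × StrList n m | ∀ q s, p < (R q).prob z.1 z.2 s → ¬ M q s} : ℝ) ≤
      2 ^ (n ^ 2) *
        #{z : StrList n m × StrList n m | (∀ q s, p' < (R q).prob z.1 z.2 s → ¬ M q s) ∧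
            ∀ j s, p' < (R' j).prob z.1 z.2 s → ¬ IsMissingXor z.1 z.2 s} +
      (1 / 2) ^ (2 * n) * Fintype.card (StrList n m × StrList n m) := by
  have hn0 : (0 : ℝ) < n := by exact_mod_cast (by omega : 0 < n)
  have hg0 : 0 < g := lt_of_lt_of_le (by positivity) hg
  have hn3 : 1024 * 1024 * n ≤ n ^ 3 := by nlinarith [Nat.mul_le_mul hn hn]
  have hn4 : 16 * n ^ 3 ≤ n ^ 4 := by
    rw [pow_succ n 3, mul_comm]; exact Nat.mul_le_mul_left _ (by omega)
  have hn23 : n ^ 2 ≤ n ^ 3 := Nat.pow_le_pow_right (by omega) (by norm_num)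
  have hD : 8 * (n ^ 12 + Fintype.card J * (n + 3) + 1) < m := by
    have h1 : n ^ 2 ≤ n ^ 12 := Nat.pow_le_pow_right (by omega) (by norm_num)
    have h2 : 1 ≤ n ^ 12 := Nat.one_le_pow _ _ (by omega)
    have h3 : n ^ 13 ≤ n ^ 100 := Nat.pow_le_pow_right (by omega) (by norm_num)
    have h4 : n ^ 12 * 1024 ≤ n ^ 13 := by
      rw [pow_succ n 12]; exact Nat.mul_le_mul_left _ hn
    rw [hm]
    omega
  have h := card_fail_le_of_samples R M R' hO hR hR' (n ^ 6) hD hp hg0 hg1 hpp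
  set k := Fintype.card ι + Fintype.card J with hk
  set N : ℝ := ((Fintype.card (StrList n m × StrList n m) : ℕ) : ℝ) with hN
  set E := 2 * (Fintype.card J * (n + 3)) with hE
  have hexp : Real.exp (-(((n ^ 6 : ℕ) : ℝ) * g ^ 2 / 4)) ≤ (1 / 2) ^ (4 * n ^ 3) := by
    have h1 : ((4 * n ^ 3 : ℕ) : ℝ) ≤ ((n ^ 6 : ℕ) : ℝ) * g ^ 2 / 4 := by
      have h2 : (1 : ℝ) ≤ (n * g) ^ 2 := by
        refine one_le_pow₀ ?_
        rw [div_le_iff₀ hn0] at hg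
        linarith
      have h3 : (16 * n ^ 3 : ℝ) ≤ n ^ 4 := by exact_mod_cast hn4
      push_cast
      have h5 : (n : ℝ) ^ 6 * g ^ 2 = n ^ 4 * (n * g) ^ 2 := by ring
      have h6 : (n : ℝ) ^ 4 * 1 ≤ n ^ 4 * (n * g) ^ 2 := by gcongr
      linarith
    have h2 : Real.exp (-1) ≤ 1 / 2 := by
      rw [Real.exp_neg, one_div]
      have := Real.add_one_le_exp (1 : ℝ)
      exact inv_anti₀ (by norm_num) (by linarith)
    calc Real.exp (-(((n ^ 6 : ℕ) : ℝ) * g ^ 2 / 4))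
        ≤ Real.exp (((4 * n ^ 3 : ℕ) : ℝ) * (-1)) := Real.exp_le_exp.mpr (by linarith)
      _ = Real.exp (-1) ^ (4 * n ^ 3) := Real.exp_nat_mul _ _
      _ ≤ _ := pow_le_pow_left₀ (Real.exp_pos _).le h2 _
  have hkn : (k : ℝ) ≤ 2 ^ n := by
    exact_mod_cast hcard.trans Nat.lt_two_pow_self.le
  have hβ : (k : ℝ) * (2 ^ n * Real.exp (-(((n ^ 6 : ℕ) : ℝ) * g ^ 2 / 4)) * N) ≤
      (1 / 2) ^ (3 * n ^ 3) * N := by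
    calc (k : ℝ) * (2 ^ n * Real.exp (-(((n ^ 6 : ℕ) : ℝ) * g ^ 2 / 4)) * N)
        ≤ 2 ^ n * (2 ^ n * (1 / 2) ^ (4 * n ^ 3) * N) := by gcongr
      _ = (2 ^ (n + n) * (1 / 2) ^ (4 * n ^ 3)) * N := by ring
      _ ≤ _ := by
          gcongr
          exact two_pow_mul_half_pow_le (by omega)
  have hE2 : (2 : ℝ) ^ E ≤ 2 ^ (n ^ 2) := pow_le_pow_right₀ (by norm_num) hJ
  have hlab : (2 : ℝ) ^ (n ^ 4 * n ^ 6 * k) * ((1 / 2) ^ (n ^ 12) * N) ≤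
      (1 / 2) ^ (2 * n ^ 3) * N := by
    rw [← mul_assoc]
    gcongr
    refine two_pow_mul_half_pow_le ?_
    have h1 : n ^ 4 * n ^ 6 * k ≤ n ^ 11 := by
      calc n ^ 4 * n ^ 6 * k ≤ n ^ 4 * n ^ 6 * n := Nat.mul_le_mul_left _ hcard
        _ = n ^ 11 := by ring
    have h2 : n ^ 3 ≤ n ^ 11 := Nat.pow_le_pow_right (by omega) (by norm_num)
    have h3 : n ^ 11 * 1024 ≤ n ^ 12 := by
      rw [pow_succ n 11]; exact Nat.mul_le_mul_left _ hn
    omega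
  have hfin : 3 * ((1 / 2) ^ (2 * n ^ 3) * N) ≤ (1 / 2) ^ (2 * n) * N := by
    calc 3 * ((1 / 2) ^ (2 * n ^ 3) * N) ≤ 2 ^ 2 * ((1 / 2) ^ (2 * n ^ 3) * N) := by
          gcongr; norm_num
      _ = (2 ^ 2 * (1 / 2) ^ (2 * n ^ 3)) * N := by ring
      _ ≤ _ := by
          gcongr
          exact two_pow_mul_half_pow_le (by omega)
  have hβ1 : (2 : ℝ) ^ (n ^ 2) * ((1 / 2) ^ (3 * n ^ 3) * N) ≤ (1 / 2) ^ (2 * n ^ 3) * N := by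
    rw [← mul_assoc]
    gcongr
    exact two_pow_mul_half_pow_le (by omega)
  have hβ2 : (1 / 2 : ℝ) ^ (3 * n ^ 3) * N ≤ (1 / 2) ^ (2 * n ^ 3) * N := by
    gcongr ?_ * N
    exact pow_le_pow_of_le_one (by norm_num) (by norm_num) (by omega)
  refine h.trans ?_
  set W : ℝ := (#{z : StrList n m × StrList n m | (∀ q s, p' < (R q).prob z.1 z.2 s → ¬ M q s) ∧
            ∀ j s, p' < (R' j).prob z.1 z.2 s → ¬ IsMissingXor z.1 z.2 s} : ℝ) with hW
  set β := (k : ℝ) * (2 ^ n * Real.exp (-(((n ^ 6 : ℕ) : ℝ) * g ^ 2 / 4)) * N) with hβdef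
  have h5 : (2 : ℝ) ^ E * (W + β) ≤ 2 ^ (n ^ 2) * (W + (1 / 2) ^ (3 * n ^ 3) * N) := by
    have : 0 ≤ β := by positivity
    gcongr
  rw [mul_add] at h5
  linarith

end Stage

/-! ### Averaging over the other coordinates -/

section Averaging

variable {κ : Type} [Fintype κ] [DecidableEq κ] {α : κ → Type} [∀ k, Fintype (α k)]

-- Exchanging coordinate `i` of `z` with `w` is an involution on the pairs `(z, w)`, so resampling
-- one coordinate preserves the uniform measure.
open Classical in
theorem sum_card_update (i : κ) (P : ((k : κ) → α k) × ((k : κ) → α k) → Prop) :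
    ∑ z : ((k : κ) → α k) × ((k : κ) → α k),
        (#{w : α i × α i | P (Function.update z.1 i w.1, Function.update z.2 i w.2)} : ℝ) =
      Fintype.card (α i × α i) * #{z | P z} := by
  let e : (((k : κ) → α k) × ((k : κ) → α k)) × (α i × α i) →
      (((k : κ) → α k) × ((k : κ) → α k)) × (α i × α i) := fun v =>
    ((Function.update v.1.1 i v.2.1, Function.update v.1.2 i v.2.2), (v.1.1 i, v.1.2 i))
  have he : Function.Involutive e := by
    rintro ⟨⟨x, y⟩, ⟨a, b⟩⟩
    simp [e]
  simp only [Finset.card_filter]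
  push_cast
  rw [← Fintype.sum_prod_type'
    (f := fun (z : ((k : κ) → α k) × ((k : κ) → α k)) (w : α i × α i) =>
      if P (Function.update z.1 i w.1, Function.update z.2 i w.2) then (1 : ℝ) else 0)]
  rw [Fintype.sum_bijective e he.bijective _
    (fun v => if P v.1 then (1 : ℝ) else 0) (fun v => rfl)]
  rw [Fintype.sum_prod_type, Finset.mul_sum]
  refine Finset.sum_congr rfl fun z _ => ?_
  change ∑ _w : α i × α i, (if P z then (1 : ℝ) else 0) = _
  rw [Finset.sum_const, Finset.card_univ, nsmul_eq_mul]

open Classical in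
theorem card_le_of_forall_update (i : κ) [Nonempty (α i)]
    (P P' : ((k : κ) → α k) × ((k : κ) → α k) → Prop) (a b : ℝ)
    (h : ∀ z : ((k : κ) → α k) × ((k : κ) → α k),
      (#{w : α i × α i | P (Function.update z.1 i w.1, Function.update z.2 i w.2)} : ℝ) ≤
        a * #{w : α i × α i | P' (Function.update z.1 i w.1, Function.update z.2 i w.2)} +
          b * Fintype.card (α i × α i)) :
    (#{z | P z} : ℝ) ≤
      a * #{z | P' z} + b * Fintype.card (((k : κ) → α k) × ((k : κ) → α k)) := by
  have hsum := Finset.sum_le_sum fun z (_ : z ∈ univ) => h z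
  rw [sum_card_update, Finset.sum_add_distrib, ← Finset.mul_sum, sum_card_update,
    Finset.sum_const, Finset.card_univ, nsmul_eq_mul] at hsum
  have hpos : (0 : ℝ) < Fintype.card (α i × α i) := by exact_mod_cast Fintype.card_pos
  refine le_of_mul_le_mul_left (hsum.trans (le_of_eq ?_)) hpos
  ring

end Averaging

/-! ### Protocols on transformed inputs -/

section Comap

variable {A B A' B' O : Type}

/-- The protocol in which the parties first transform their inputs. -/
def DetProtocol.comap (u : A' → A) (v : B' → B) : DetProtocol A B O → DetProtocol A' B' O
  | output o => output o
  | alice f next => alice (f ∘ u) fun b => (next b).comap u v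
  | bob g next => bob (g ∘ v) fun b => (next b).comap u v

theorem DetProtocol.run_comap (u : A' → A) (v : B' → B) (P : DetProtocol A B O) (x : A') (y : B') :
    (P.comap u v).run x y = P.run (u x) (v y) := by
  induction P with
  | output o => rfl
  | alice f next ih => exact ih _
  | bob g next ih => exact ih _

theorem DetProtocol.bits_comap (u : A' → A) (v : B' → B) (P : DetProtocol A B O) (x : A')
    (y : B') : (P.comap u v).bits x y = P.bits (u x) (v y) := by
  induction P with
  | output o => rfl
  | alice f next ih => exact congrArg (· + 1) (ih _)
  | bob g next ih => exact congrArg (· + 1) (ih _)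

/-- The randomized protocol in which the parties first transform their inputs. -/
def RandProtocol.comap (u : A' → A) (v : B' → B) (Q : RandProtocol A B O) :
    RandProtocol A' B' O where
  coins := Q.coins
  det r := (Q.det r).comap u v

theorem RandProtocol.prob_comap (u : A' → A) (v : B' → B) (Q : RandProtocol A B O) (x : A')
    (y : B') (o : O) : (Q.comap u v).prob x y o = Q.prob (u x) (v y) o := by
  classical
  change ((#{r : BitStr Q.coins | ((Q.det r).comap u v).run x y = o} : ℕ) : ℝ) / 2 ^ Q.coins = _
  simp only [DetProtocol.run_comap, RandProtocol.prob]

theorem RandProtocol.complexity_comap_le (u : A' → A) (v : B' → B) (Q : RandProtocol A B O)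
    {c : ℕ} (h : Q.complexity ≤ (c : ℕ∞)) : (Q.comap u v).complexity ≤ (c : ℕ∞) := by
  simp only [RandProtocol.complexity, iSup_le_iff, Nat.cast_le]
  intro r x y
  exact (DetProtocol.bits_comap u v _ x y).le.trans (RandProtocol.bits_le h r _ _)

end Comap

theorem RandProtocol.eq_of_half_lt_prob {A B O : Type} (Q : RandProtocol A B O) (x : A) (y : B)
    {s s' : O} (hs : 1 / 2 < Q.prob x y s) (hs' : 1 / 2 < Q.prob x y s') : s = s' := by
  classical
  by_contra hne
  have hdisj : Disjoint ({r | (Q.det r).run x y = s} : Finset (BitStr Q.coins))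
      ({r | (Q.det r).run x y = s'} : Finset (BitStr Q.coins)) := by
    rw [Finset.disjoint_filter]
    rintro r - rfl
    exact hne
  have h1 := Finset.card_le_univ (({r | (Q.det r).run x y = s} : Finset (BitStr Q.coins)) ∪
    ({r | (Q.det r).run x y = s'} : Finset (BitStr Q.coins)))
  rw [Finset.card_union_of_disjoint hdisj] at h1
  have h2 : (#{r | (Q.det r).run x y = s} : ℝ) + #{r | (Q.det r).run x y = s'} ≤
      Fintype.card (BitStr Q.coins) := by exact_mod_cast h1
  have h3 := Q.prob_eq x y s
  have h4 := Q.prob_eq x y s'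
  have h5 : (0 : ℝ) < Fintype.card (BitStr Q.coins) := by exact_mod_cast Fintype.card_pos
  have h6 : Q.prob x y s * Fintype.card (BitStr Q.coins) +
      Q.prob x y s' * Fintype.card (BitStr Q.coins) ≤ Fintype.card (BitStr Q.coins) := by
    rw [← h3, ← h4]
    convert h2
  nlinarith

/-! ### Thresholds and string lengths -/

theorem threshold_ge {t : ℕ} (ht : 1 ≤ t) : (6 / 10 : ℝ) ≤ threshold t := by
  induction t, ht using Nat.le_induction with
  | base => norm_num [threshold]
  | succ t ht ih =>
    obtain ⟨k, rfl⟩ := Nat.exists_eq_add_of_le' ht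
    rw [threshold]
    have : (0 : ℝ) ≤ 1 / (10 * ((k + 2 : ℕ) : ℝ) ^ 2) := by positivity
    linarith

theorem strLen_succ_eq (C i : ℕ) : strLen C (i + 1) = 2 ^ (C * 4 ^ i) := by
  induction i with
  | zero => simp [strLen]
  | succ i ih =>
    rw [strLen, ih, ← pow_mul]
    congr 1
    ring

theorem strLen_mono (C : ℕ) {i k : ℕ} (h : i ≤ k) : strLen C (i + 1) ≤ strLen C (k + 1) := by
  rw [strLen_succ_eq, strLen_succ_eq]
  exact Nat.pow_le_pow_right (by norm_num)
    (Nat.mul_le_mul_left _ (Nat.pow_le_pow_right (by norm_num) h))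

/-- Both the number of protocols handled up to a stage and the inverse of its threshold gap are
quadratic in the index; this keeps them below the string length. -/
theorem sq_mul_le_strLen {C : ℕ} (hC : 10 ≤ C) (i : ℕ) :
    1024 * (i + 1) ^ 2 ≤ strLen C (i + 1) := by
  have h1 : 10 * (i + 1) ≤ C * 4 ^ i := Nat.mul_le_mul hC (Nat.lt_pow_self (by norm_num))
  have h2 : i + 1 ≤ 2 ^ i := Nat.lt_two_pow_self
  calc 1024 * (i + 1) ^ 2 ≤ 1024 * (2 ^ i) ^ 2 := by gcongr
    _ = 2 ^ (10 + 2 * i) := by rw [pow_add]; ring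
    _ ≤ 2 ^ (C * 4 ^ i) := Nat.pow_le_pow_right (by norm_num) (by omega)
    _ = _ := (strLen_succ_eq C i).symm

/-! ### Induction on the instances -/

/-- All protocols `Q k j` with `k < i` fail on `z` with threshold `p`. -/
def AllFailBelow {C t : ℕ} (Q : (i j : Fin t) → j ≤ i →
      RandProtocol (MultiInput C t) (MultiInput C t) (BitStr (strLen C (i + 1))))
    (i : ℕ) (p : ℝ) (z : MultiInput C t × MultiInput C t) : Prop :=
  ∀ (k j : Fin t) (h : j ≤ k), k.val < i → ∀ s, p < (Q k j h).prob z.1 z.2 s →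
    ¬ IsMissingXor (z.1 k) (z.2 k) s

/-- Thresholds increasing from `1 / 2` towards `6 / 10`. -/
noncomputable def lowThreshold (i : ℕ) : ℝ := 6 / 10 - 1 / (10 * (i + 1))

theorem half_le_lowThreshold (i : ℕ) : 1 / 2 ≤ lowThreshold i := by
  have : (1 : ℝ) / (10 * (i + 1)) ≤ 1 / 10 := by
    apply one_div_le_one_div_of_le (by norm_num)
    have : (0 : ℝ) ≤ i := by positivity
    linarith
  rw [lowThreshold]
  linarith

theorem lowThreshold_le (i : ℕ) : lowThreshold i ≤ 6 / 10 := by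
  have : (0 : ℝ) ≤ 1 / (10 * (i + 1)) := by positivity
  rw [lowThreshold]
  linarith

/-- The gaps telescope because `1 / ((i + 1) * (i + 2))` is a difference of reciprocals. -/
theorem lowThreshold_add (i : ℕ) :
    lowThreshold i + 2 * (1 / (20 * ((i + 1) * (i + 2)))) = lowThreshold (i + 1) := by
  have h1 : (i : ℝ) + 1 ≠ 0 := by positivity
  have h2 : (i : ℝ) + 2 ≠ 0 := by positivity
  rw [lowThreshold, lowThreshold]
  push_cast
  rw [show (i : ℝ) + 1 + 1 = i + 2 by ring]
  field_simp
  ring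

open Classical in
theorem card_allFailBelow_le {C t : ℕ} (hC : 10 ≤ C) (Q : (i j : Fin t) → j ≤ i →
      RandProtocol (MultiInput C t) (MultiInput C t) (BitStr (strLen C (i + 1))))
    (hQ : ∀ (i j : Fin t) (h : j ≤ i),
      (Q i j h).complexity ≤ ((strLen C (i + 1) ^ 4 : ℕ) : ℕ∞)) (i : Fin t) :
    (#{z | AllFailBelow Q i (lowThreshold i) z} : ℝ) ≤
      2 ^ (strLen C (i + 1) ^ 2) * #{z | AllFailBelow Q (i + 1) (lowThreshold (i + 1)) z} +
      (1 / 2) ^ (2 * strLen C (i + 1)) * Fintype.card (MultiInput C t × MultiInput C t) := by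
  refine card_le_of_forall_update i _ _ _ _ fun z => ?_
  let ι := {q : Fin t × Fin t // q.2 ≤ q.1 ∧ q.1.val < i.val}
  let J := {j : Fin t // j ≤ i}
  have hn := sq_mul_le_strLen hC i
  have hι : Fintype.card ι ≤ (i + 1 : ℕ) ^ 2 := by
    let e : ι → Fin (i + 1) × Fin (i + 1) := fun q =>
      (⟨q.1.1, by have := q.2.2; omega⟩, ⟨q.1.2, by have := q.2.2; have := q.2.1; omega⟩)
    have he : Function.Injective e := by
      rintro ⟨⟨a, b⟩, _⟩ ⟨⟨a', b'⟩, _⟩ h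
      simp only [e, Prod.mk.injEq, Fin.mk.injEq] at h
      exact Subtype.ext (Prod.ext (Fin.ext h.1) (Fin.ext h.2))
    have := Fintype.card_le_of_injective e he
    simpa [sq] using this
  have hJ : Fintype.card J ≤ i + 1 := by
    let e : J → Fin (i + 1) := fun j => ⟨j.1, by have := j.2; omega⟩
    have he : Function.Injective e := by
      rintro ⟨a, _⟩ ⟨a', _⟩ h
      simp only [e, Fin.mk.injEq] at h
      exact Subtype.ext (Fin.ext h)
    simpa using Fintype.card_le_of_injective e he
  set n := strLen C (i + 1) with hndef
  have hi : (i : ℕ) + 1 ≤ (i + 1) ^ 2 := Nat.le_self_pow (by norm_num) _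
  have hmain := card_fail_le (n := n) (m := listLen C (i + 1)) (ι := ι) (J := J)
    (O := fun q => BitStr (strLen C (q.1.1 + 1)))
    (fun q => (Q q.1.1 q.1.2 q.2.1).comap (Function.update z.1 i) (Function.update z.2 i))
    -- The earlier instances are frozen at `z`, so this predicate does not involve the lists that
    -- vary.
    (fun q s => IsMissingXor (z.1 q.1.1) (z.2 q.1.1) s)
    (fun j => (Q i j.1 j.2).comap (Function.update z.1 i) (Function.update z.2 i))
    (fun q => by
      rw [Fintype.card_fun, Fintype.card_fin, Fintype.card_bool]
      exact Nat.pow_le_pow_right (by norm_num) (strLen_mono C q.2.2.le))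
    (fun q => RandProtocol.complexity_comap_le _ _ _ ((hQ _ _ _).trans
      (Nat.cast_le.mpr (Nat.pow_le_pow_left (strLen_mono C q.2.2.le) 4))))
    (fun j => RandProtocol.complexity_comap_le _ _ _ (hQ _ _ _))
    (by nlinarith) rfl (by omega)
    (by
      calc 2 * (Fintype.card J * (n + 3)) ≤ 2 * ((i + 1) * (n + n)) := by gcongr; omega
        _ = (4 * (i + 1)) * n := by ring
        _ ≤ n * n := by gcongr; omega
        _ = n ^ 2 := (sq n).symm)
    (half_le_lowThreshold i) (g := 1 / (20 * (((i : ℕ) + 1) * ((i : ℕ) + 2))))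
    (by
      apply one_div_le_one_div_of_le (by positivity)
      have : 20 * (((i : ℕ) + 1) * ((i : ℕ) + 2)) ≤ n := by nlinarith
      exact_mod_cast this)
    (by
      rw [div_le_one (by positivity)]
      have : (0 : ℝ) ≤ (i : ℕ) := by positivity
      nlinarith)
    (lowThreshold_add i).le
  simp only [RandProtocol.prob_comap] at hmain
  refine le_trans (Nat.cast_le.mpr (Finset.card_le_card fun w hw => ?_))
    (hmain.trans (add_le_add_left (mul_le_mul_of_nonneg_left
      (Nat.cast_le.mpr (Finset.card_le_card fun w hw => ?_)) (by positivity)) _))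
  · simp only [Finset.mem_filter, Finset.mem_univ, true_and] at hw ⊢
    rintro ⟨⟨k, j⟩, hjk, hk⟩ s hs
    have hne : k ≠ i := fun h => by rw [h] at hk; exact lt_irrefl _ hk
    have := hw k j hjk hk s hs
    simpa only [Function.update_of_ne hne] using this
  · simp only [Finset.mem_filter, Finset.mem_univ, true_and] at hw ⊢
    intro k j hjk hk s hs
    rcases Nat.lt_succ_iff_lt_or_eq.mp hk with hk' | hk'
    · have hne : k ≠ i := fun h => by rw [h] at hk'; exact lt_irrefl _ hk'
      simp only [Function.update_of_ne hne]
      exact hw.1 ⟨⟨k, j⟩, hjk, hk'⟩ s hs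
    · obtain rfl := Fin.ext hk'
      simp only [Function.update_self]
      exact hw.2 ⟨j, hjk⟩ s hs

-- With `n` the length at the current step, half of the density `2 ^ (-n)` covers the error `2 ^ (-2
-- * n)`. The remaining `2 ^ (-n - 1)`, divided by `2 ^ (n ^ 2)`, still exceeds `2 ^ (-n ^ 4)`; this
-- is where the fourth-power growth of the lengths is used. For `i = t` the length in the bound lies
-- one past the last instance.
open Classical in
theorem card_allFailBelow_ge {C t : ℕ} (hC : 10 ≤ C) (Q : (i j : Fin t) → j ≤ i →
      RandProtocol (MultiInput C t) (MultiInput C t) (BitStr (strLen C (i + 1))))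
    (hQ : ∀ (i j : Fin t) (h : j ≤ i),
      (Q i j h).complexity ≤ ((strLen C (i + 1) ^ 4 : ℕ) : ℕ∞)) {i : ℕ} (hi : i ≤ t) :
    (1 / 2 : ℝ) ^ strLen C (i + 1) * Fintype.card (MultiInput C t × MultiInput C t) ≤
      #{z | AllFailBelow Q i (lowThreshold i) z} := by
  induction i with
  | zero =>
    have : ({z | AllFailBelow Q 0 (lowThreshold 0) z} : Finset _) = univ := by
      ext z
      simp [AllFailBelow]
    rw [this, Finset.card_univ]
    exact mul_le_of_le_one_left (by positivity) (pow_le_one₀ (by norm_num) (by norm_num))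
  | succ i ih =>
    have h1 := ih (by omega)
    have h2 := card_allFailBelow_le hC Q hQ ⟨i, by omega⟩
    simp only at h2
    have hn := sq_mul_le_strLen hC i
    have h4 : strLen C (i + 1 + 1) = strLen C (i + 1) ^ 4 := rfl
    set n := strLen C (i + 1) with hndef
    set N : ℝ := ((Fintype.card (MultiInput C t × MultiInput C t) : ℕ) : ℝ) with hN
    rw [h4]
    have hn1 : 1024 ≤ n := by nlinarith
    have h5 : (1 / 2 : ℝ) ^ (2 * n) ≤ (1 / 2) ^ (n + 1) :=
      pow_le_pow_of_le_one (by norm_num) (by norm_num) (by omega)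
    have h6 : (2 : ℝ) ^ (n ^ 2) * (1 / 2) ^ (n ^ 4) ≤ (1 / 2) ^ (n + 1) := by
      refine two_pow_mul_half_pow_le ?_
      have : n ^ 2 * 1024 ≤ n ^ 4 := by
        calc n ^ 2 * 1024 ≤ n ^ 2 * n ^ 2 := Nat.mul_le_mul_left _ (by nlinarith)
          _ = n ^ 4 := by ring
      nlinarith
    have h7 : (1 / 2 : ℝ) ^ n = (1 / 2) ^ (n + 1) + (1 / 2) ^ (n + 1) := by
      rw [pow_succ]; ring
    have hN0 : 0 ≤ N := by positivity
    refine le_of_mul_le_mul_left ?_ (by positivity : (0 : ℝ) < 2 ^ (n ^ 2))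
    have h8 := mul_le_mul_of_nonneg_right h5 hN0
    have h9 := mul_le_mul_of_nonneg_right h6 hN0
    rw [h7] at h1
    linarith

theorem mainTheorem5 :
    ∃ C₀ : ℕ, ∀ C : ℕ, C₀ ≤ C → ∀ t : ℕ, 1 ≤ t →
      ∀ Q : (i j : Fin t) → j ≤ i →
          RandProtocol (MultiInput C t) (MultiInput C t) (BitStr (strLen C (i + 1))),
        (∀ (i j : Fin t) (h : j ≤ i),
          (Q i j h).complexity ≤ ((strLen C (i + 1) ^ 4 : ℕ) : ℕ∞)) →
        ∃ X Y : MultiInput C t, ∀ (i j : Fin t) (h : j ≤ i),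
          FailsOn (Q i j h) X Y (threshold t) (X i) (Y i) := by
  classical
  -- `C ≥ 10` makes every string length at least `1024`.
  refine ⟨10, fun C hC t ht Q hQ => ?_⟩
  have h1 := card_allFailBelow_ge hC Q hQ le_rfl
  have h2 : (0 : ℝ) < #{z | AllFailBelow Q t (lowThreshold t) z} := by
    refine lt_of_lt_of_le (mul_pos (by positivity) ?_) h1
    exact_mod_cast Fintype.card_pos
  have h3 : 0 < #{z | AllFailBelow Q t (lowThreshold t) z} := by exact_mod_cast h2
  obtain ⟨z, hz⟩ := Finset.card_pos.mp h3
  have hz' := (Finset.mem_filter.mp hz).2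
  have hthr := threshold_ge ht
  have hlow := lowThreshold_le t
  refine ⟨z.1, z.2, fun i j h => ?_⟩
  by_cases hs : ∃ s, (Q i j h).prob z.1 z.2 s > threshold t
  · obtain ⟨s, hs⟩ := hs
    refine Or.inr ⟨s, hs, fun s' hs' => ?_, hz' i j h i.isLt s (by linarith)⟩
    exact (Q i j h).eq_of_half_lt_prob z.1 z.2 (by linarith) (by linarith)
  · exact Or.inl hs
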